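/- Let $Q=\{1,\dots,p\}$ and, for each $q\in Q$, let $f_q:\mathbb{R}^n\to\mathbb{R}$ be a convex function and $C_q\subset\mathbb{R}^n$ a nonempty closed convex set. Put $$M_q(x)=\partial f_q(x)+N_{C_q}(x),$$ where $\partial f_q(x)=\{y : f_q(x')\ge f_q(x)+y\cdot(x'-x)\ \forall x'\in\mathbb{R}^n\}$ is the convex subdifferential, and $N_{C_q}(x)=\{v : v\cdot(x'-x)\le 0\ \forall x'\in C_q\}$ if $x\in C_q$, $N_{C_q}(x)=\emptyset$ if $x\notin C_q$, is the normal cone. A switching signal is a function $\sigma:[0,\infty)\to Q$ for which there are times $0=t_0<t_1<t_2<\cdots$ with $t_j\to\infty$ such that $\sigma$ is constant on each $[t_j,t_{j+1})$. Given a switching signal $\sigma$, a solution of the switching system $\dot x\in -M_{\sigma}(x)$ is a locally absolutely continuous function $\phi:\operatorname{dom}\phi\to\mathbb{R}^n$, where $\operatorname{dom}\phi$ is $[0,T)$ or $[0,T]$ for some $T>0$, or $[0,\infty)$, such that $\dot\phi(t)\in -M_{\sigma(t)}(\phi(t))$ for almost every $t\in\operatorname{dom}\phi$. A solution is maximal if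 it cannot be extended to a solution with a strictly larger domain, and complete if its domain is $[0,\infty)$. Then, for every switching signal $\sigma$ and every $x_0\in C_{\sigma(0)}$, there exists a unique maximal solution $\phi$ with $\phi(0)=x_0$. If this solution is bounded, then it is uniformly continuous on its domain. If $C_1=C_2=\dots=C_p$, then this solution is complete. -/

import Mathlib

open Set Filter Topology MeasureTheory
open scoped Pointwise

namespace SwitchingSystem

/-- The convex subdifferential of `g` at `x`. -/
def subdifferential {n : ℕ} (g : EuclideanSpace ℝ (Fin n) → ℝ) (x : EuclideanSpace ℝ (Fin n)) :
    Set (EuclideanSpace ℝ (Fin n)) :=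
  {y | ∀ x', g x + inner ℝ y (x' - x) ≤ g x'}

/-- The normal cone to `D` at `x`; it is empty when `x ∉ D`. -/
def normalCone {n : ℕ} (D : Set (EuclideanSpace ℝ (Fin n))) (x : EuclideanSpace ℝ (Fin n)) :
    Set (EuclideanSpace ℝ (Fin n)) :=
  {v | x ∈ D ∧ ∀ x' ∈ D, inner ℝ v (x' - x) ≤ 0}

/-- The set-valued mapping `x ↦ ∂g(x) + N_D(x)` (a Minkowski sum of sets). -/
def flowMap {n : ℕ} (g : EuclideanSpace ℝ (Fin n) → ℝ) (D : Set (EuclideanSpace ℝ (Fin n)))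
    (x : EuclideanSpace ℝ (Fin n)) : Set (EuclideanSpace ℝ (Fin n)) :=
  subdifferential g x + normalCone D x

/-- `σ` is a switching signal: there are switching times `0 = t₀ < t₁ < ⋯`, tending to infinity,
such that `σ` is constant on each `[t_j, t_{j+1})`. Only the values of `σ` on `[0, ∞)` matter. -/
def IsSwitchingSignal {p : ℕ} (σ : ℝ → Fin p) : Prop :=
  ∃ t : ℕ → ℝ, t 0 = 0 ∧ StrictMono t ∧ Tendsto t atTop atTop ∧
    ∀ j, ∀ s ∈ Ico (t j) (t (j + 1)), σ s = σ (t j)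

/-- The time domains of solutions: `[0, T)`, `[0, T]` or `[0, ∞)`. -/
def IsTimeDomain (D : Set ℝ) : Prop :=
  (∃ T : ℝ, 0 < T ∧ (D = Ico 0 T ∨ D = Icc 0 T)) ∨ D = Ici 0

/-- `φ`, considered only on `D`, is locally absolutely continuous: it is absolutely continuous on
every compact interval with endpoints in the interval `D`. -/
def LocallyAbsolutelyContinuousOn {n : ℕ} (φ : ℝ → EuclideanSpace ℝ (Fin n)) (D : Set ℝ) : Prop :=
  ∀ a ∈ D, ∀ b ∈ D, AbsolutelyContinuousOnInterval φ a b

/-- The restriction of `φ` to `D` is a solution of the switching system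
`x' ∈ -(∂f_σ(x) + N_{C_σ}(x))`. -/
structure IsSolution {n p : ℕ} (f : Fin p → EuclideanSpace ℝ (Fin n) → ℝ)
    (C : Fin p → Set (EuclideanSpace ℝ (Fin n))) (σ : ℝ → Fin p)
    (D : Set ℝ) (φ : ℝ → EuclideanSpace ℝ (Fin n)) : Prop where
  timeDomain : IsTimeDomain D
  locallyAC : LocallyAbsolutelyContinuousOn φ D
  inclusion : ∀ᵐ t ∂(volume : Measure ℝ), t ∈ D →
    ∃ v, HasDerivWithinAt φ v D t ∧ v ∈ -flowMap (f (σ t)) (C (σ t)) (φ t)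

/-- A solution is maximal if no solution with a strictly larger domain extends it. -/
def IsMaximalSolution {n p : ℕ} (f : Fin p → EuclideanSpace ℝ (Fin n) → ℝ)
    (C : Fin p → Set (EuclideanSpace ℝ (Fin n))) (σ : ℝ → Fin p)
    (D : Set ℝ) (φ : ℝ → EuclideanSpace ℝ (Fin n)) : Prop :=
  IsSolution f C σ D φ ∧
    ∀ (D' : Set ℝ) (φ' : ℝ → EuclideanSpace ℝ (Fin n)),
      IsSolution f C σ D' φ' → D ⊆ D' → EqOn φ' φ D → D' = D

end SwitchingSystem

/-! Subdifferentials and normal cones are monotone, so the distance between two solutions cannot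
increase; hence `IsSolution.eq_of_mem`. As time domains are nested, maximal solutions are unique.

For one mode, implicit Euler steps are proximal minimizations of `f` over `C`. They satisfy a
discrete evolution variational inequality and a Lipschitz bound independent of the step size. Both
survive the limit (`exists_evolution`), and differentiating the inequality gives the inclusion
through the sum rule `mem_flowMap_of_forall_le`.

Modes are pasted as long as the state at each switching time lies in the next set. At the first
failure the closed interval up to that time is a maximal domain, since any continuation would force
the state into that set. Equal sets rule out failure.

Inside a mode the velocity is orthogonal to its normal component, hence bounded by subgradients of
`f`. These are bounded on bounded sets, so bounded solutions are Lipschitz. -/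

namespace SwitchingSystem

local notation "⟪" x ", " y "⟫" => inner ℝ x y

/-! ### Sum rule, monotonicity, subgradient bounds and proximal points. -/

section ConvexAnalysis

variable {n : ℕ} {f : EuclideanSpace ℝ (Fin n) → ℝ} {C : Set (EuclideanSpace ℝ (Fin n))}
  {x : EuclideanSpace ℝ (Fin n)}

theorem continuous_of_convexOn (hf : ConvexOn ℝ univ f) : Continuous f :=
  hf.locallyLipschitz.continuous

/-- The sum rule: a subgradient at `x` of the restriction of a finite convex function to a convex
set is the sum of a subgradient and a normal vector. -/
theorem mem_flowMap_of_forall_le (hf : ConvexOn ℝ univ f) (hC : Convex ℝ C) (hx : x ∈ C)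
    {η : EuclideanSpace ℝ (Fin n)} (hη : ∀ w ∈ C, f x + ⟪η, w - x⟫ ≤ f w) :
    η ∈ flowMap f C x := by
  set F : EuclideanSpace ℝ (Fin n) → ℝ := fun z => f z - f x - ⟪η, z - x⟫ with hF
  have hFc : Continuous F := by
    have := continuous_of_convexOn hf
    fun_prop
  have hconv : ∀ z w : EuclideanSpace ℝ (Fin n), ∀ a b : ℝ, 0 ≤ a → 0 ≤ b → a + b = 1 →
      F (a • z + b • w) ≤ a * F z + b * F w := by
    intro z w a b ha hb hab
    have h1 := hf.2 (mem_univ z) (mem_univ w) ha hb hab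
    have h2 : a • z + b • w - x = a • (z - x) + b • (w - x) := by
      have : x = (a + b) • x := by rw [hab, one_smul]
      nth_rw 1 [this]
      module
    simp only [hF, h2, inner_add_right, inner_smul_right]
    simp only [smul_eq_mul] at h1
    have : f x = (a + b) * f x := by rw [hab, one_mul]
    linarith
  -- Separate the open strict epigraph of `F` from `C × (-∞, 0]`; they are disjoint because `F ≥ 0`
  -- on `C`.
  let A : Set (EuclideanSpace ℝ (Fin n) × ℝ) := {p | F p.1 < p.2}
  let B : Set (EuclideanSpace ℝ (Fin n) × ℝ) := {p | p.1 ∈ C ∧ p.2 ≤ 0}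
  have hA : Convex ℝ A := by
    intro p hp q hq a b ha hb hab
    have h := hconv p.1 q.1 a b ha hb hab
    simp only [A, mem_ofPred_eq, Prod.fst_add, Prod.snd_add, Prod.smul_fst, Prod.smul_snd,
      smul_eq_mul] at hp hq ⊢
    rcases ha.eq_or_lt with rfl | ha'
    · have : b = 1 := by linarith
      subst this
      linarith
    · nlinarith [mul_lt_mul_of_pos_left hp ha', mul_le_mul_of_nonneg_left hq.le hb]
  have hAo : IsOpen A := isOpen_lt (hFc.comp continuous_fst) continuous_snd
  have hB : Convex ℝ B := by
    intro p hp q hq a b ha hb hab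
    refine ⟨hC hp.1 hq.1 ha hb hab, ?_⟩
    have h1 := mul_nonneg ha (neg_nonneg.2 hp.2)
    have h2 := mul_nonneg hb (neg_nonneg.2 hq.2)
    simp only [Prod.snd_add, Prod.smul_snd, smul_eq_mul]
    linarith
  have hAB : Disjoint A B := by
    rw [Set.disjoint_left]
    rintro ⟨z, r⟩ h1 ⟨h2, h3⟩
    have := hη z h2
    simp only [A, mem_ofPred_eq, hF] at h1 h3
    linarith
  obtain ⟨ℓ, u, hℓA, hℓB⟩ := geometric_hahn_banach_open hA hAo hB hAB
  set b : ℝ := ℓ (0, 1) with hb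
  let a : StrongDual ℝ (EuclideanSpace ℝ (Fin n)) :=
    ℓ.comp (ContinuousLinearMap.inl ℝ (EuclideanSpace ℝ (Fin n)) ℝ)
  have hℓ : ∀ z r, ℓ (z, r) = a z + r * b := by
    intro z r
    have : (z, r) = (z, (0 : ℝ)) + r • ((0 : EuclideanSpace ℝ (Fin n)), (1 : ℝ)) := by simp
    rw [this, map_add, map_smul]
    simp [a, hb]
  have hFx : F x = 0 := by simp [hF]
  have hux : u ≤ a x := by
    have := hℓB (x, 0) ⟨hx, le_rfl⟩
    rw [hℓ] at this
    linarith
  have hAlt : ∀ z (ε : ℝ), 0 < ε → a z + (F z + ε) * b < u := by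
    intro z ε hε
    have := hℓA (z, F z + ε) (by simp [A, hε])
    rwa [hℓ] at this
  -- The hyperplane is not vertical: `(x, 1)` lies in `A` above the point `(x, 0)` of `B`.
  have hb0 : b < 0 := by
    have := hAlt x 1 one_pos
    rw [hFx] at this
    linarith
  have hAle : ∀ z, a z + F z * b ≤ u := by
    intro z
    have h : Tendsto (fun ε : ℝ => a z + (F z + ε) * b) (𝓝[>] 0) (𝓝 (a z + (F z + 0) * b)) := by
      apply Tendsto.mono_left _ nhdsWithin_le_nhds
      apply Continuous.tendsto
      fun_prop
    rw [add_zero] at h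
    exact le_of_tendsto h (by filter_upwards [self_mem_nhdsWithin] with ε hε using (hAlt z ε hε).le)
  have hxu : a x ≤ u := by simpa [hFx] using hAle x
  obtain ⟨c, hc⟩ : ∃ c : EuclideanSpace ℝ (Fin n), ∀ z, a z = ⟪c, z⟫ :=
    ⟨(InnerProductSpace.toDual ℝ _).symm a, fun z => by simp⟩
  -- Normalized by `-b`, the slope `c` is a subgradient of `F` at `x` and its negative is normal to
  -- `C`.
  refine ⟨η + (-b)⁻¹ • c, ?_, -((-b)⁻¹ • c), ⟨hx, ?_⟩, by simp⟩
  · intro z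
    have h1 := (hAle z).trans hux
    have h2 : (-b)⁻¹ * ⟪c, z - x⟫ ≤ F z := by
      rw [inv_mul_le_iff₀ (by linarith), inner_sub_right, ← hc, ← hc]
      linarith
    rw [inner_add_left, real_inner_smul_left]
    simp only [hF] at h2
    linarith
  · intro z hz
    have h1 := hℓB (z, 0) ⟨hz, le_rfl⟩
    rw [hℓ] at h1
    have h2 : 0 ≤ ⟪c, z - x⟫ := by
      rw [inner_sub_right, ← hc, ← hc]
      linarith
    rw [inner_neg_left, real_inner_smul_left]
    have : 0 ≤ (-b)⁻¹ := inv_nonneg.2 (by linarith)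
    nlinarith [mul_nonneg this h2]

/-- On the singleton `{x}` the inequality required by the sum rule is trivial for `η = 0`. -/
theorem subdifferential_nonempty (hf : ConvexOn ℝ univ f) (x : EuclideanSpace ℝ (Fin n)) :
    (subdifferential f x).Nonempty := by
  have h : (0 : EuclideanSpace ℝ (Fin n)) ∈ flowMap f {x} x :=
    mem_flowMap_of_forall_le hf (convex_singleton x) (mem_singleton x) (by simp)
  obtain ⟨g, hg, -⟩ := h
  exact ⟨g, hg⟩

theorem inner_sub_nonneg_of_mem_flowMap {y u v : EuclideanSpace ℝ (Fin n)}
    (hu : u ∈ flowMap f C x) (hv : v ∈ flowMap f C y) : 0 ≤ ⟪u - v, x - y⟫ := by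
  obtain ⟨g, hg, w, hw, rfl⟩ := hu
  obtain ⟨g', hg', w', hw', rfl⟩ := hv
  have h1 := hg y
  have h2 := hg' x
  have h3 := hw.2 y hw'.1
  have h4 := hw'.2 x hw.1
  simp only [inner_sub_left, inner_sub_right, inner_add_left] at *
  linarith

/-- A unit step along `g` raises `f` by at least `‖g‖`, while `f` is bounded on the ball of radius
`R + 1`. -/
theorem exists_subgradient_bound (hf : ConvexOn ℝ univ f) (R : ℝ) :
    ∃ L, 0 ≤ L ∧ ∀ x, ‖x‖ ≤ R → ∀ g ∈ subdifferential f x, ‖g‖ ≤ L := by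
  obtain ⟨M, hM⟩ := (isCompact_closedBall (0 : EuclideanSpace ℝ (Fin n)) (R + 1)
    ).exists_bound_of_continuousOn (continuous_of_convexOn hf).continuousOn
  refine ⟨max (2 * M) 0, le_max_right _ _, fun x hx g hg => ?_⟩
  rcases eq_or_ne g 0 with rfl | hg0
  · simp
  have hpos : 0 < ‖g‖ := norm_pos_iff.2 hg0
  have h1 := hg (x + ‖g‖⁻¹ • g)
  have h2 : ⟪g, x + ‖g‖⁻¹ • g - x⟫ = ‖g‖ := by
    rw [add_sub_cancel_left, real_inner_smul_right, real_inner_self_eq_norm_sq]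
    field_simp
  have h3 : ‖x + ‖g‖⁻¹ • g‖ ≤ R + 1 := by
    refine (norm_add_le _ _).trans (add_le_add hx ?_)
    rw [norm_smul, norm_inv, norm_norm, inv_mul_cancel₀ hpos.ne']
  have h4 := hM x (by simp; linarith)
  have h5 := hM (x + ‖g‖⁻¹ • g) (by simpa using h3)
  rw [Real.norm_eq_abs, abs_le] at h4 h5
  exact le_max_of_le_left (by linarith)

/-- The resolvent of the subdifferential of `f` restricted to `C`. -/
theorem exists_resolvent (hf : ConvexOn ℝ univ f) (hCc : IsClosed C) (hC : Convex ℝ C)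
    (hx : x ∈ C) {h : ℝ} (hh : 0 < h) :
    ∃ y ∈ C, ∀ w ∈ C, ⟪x - y, w - y⟫ ≤ h * (f w - f y) := by
  obtain ⟨g, hg⟩ := subdifferential_nonempty hf x
  have hcont := continuous_of_convexOn hf
  -- The affine minorant given by `g` shows `Φ w ≥ Φ x` outside the ball of radius `2 * h * ‖g‖`, so
  -- a compact minimization suffices.
  let Φ : EuclideanSpace ℝ (Fin n) → ℝ := fun w => 2 * h * f w + ‖w - x‖ ^ 2
  have hΦ : Continuous Φ := by fun_prop
  have hK : IsCompact (C ∩ Metric.closedBall x (2 * h * ‖g‖)) :=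
    (isCompact_closedBall _ _).inter_left hCc
  obtain ⟨y, hy, hmin⟩ := hK.exists_isMinOn ⟨x, hx, by simp; positivity⟩ hΦ.continuousOn
  have hminC : ∀ w ∈ C, Φ y ≤ Φ w := by
    intro w hw
    by_cases hwb : w ∈ Metric.closedBall x (2 * h * ‖g‖)
    · exact hmin ⟨hw, hwb⟩
    · have h1 : Φ y ≤ Φ x := hmin ⟨hx, by simp; positivity⟩
      have h2 := hg w
      have h3 := abs_le.1 (abs_real_inner_le_norm g (w - x))
      rw [Metric.mem_closedBall, dist_eq_norm, not_le] at hwb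
      have h4 : 0 ≤ ‖w - x‖ := norm_nonneg _
      refine h1.trans ?_
      simp only [Φ, sub_self, norm_zero]
      nlinarith
  refine ⟨y, hy.1, fun w hw => ?_⟩
  -- First-order optimality: compare `y` with `(1 - s) • y + s • w`, divide by `s`, then let `s →
  -- 0`.
  have key : ∀ s ∈ Ioo (0 : ℝ) 1, 2 * ⟪x - y, w - y⟫ ≤ 2 * h * (f w - f y) + s * ‖w - y‖ ^ 2 := by
    intro s hs
    have h1 := hminC _ (hC hy.1 hw (sub_nonneg.2 hs.2.le) hs.1.le (by ring))
    have h2 := hf.2 (mem_univ y) (mem_univ w) (sub_nonneg.2 hs.2.le) hs.1.le (by ring)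
    have h3 : (1 - s) • y + s • w - x = s • (w - y) - (x - y) := by module
    have h4 : ‖y - x‖ = ‖x - y‖ := norm_sub_rev _ _
    have h7 : ⟪s • (w - y), x - y⟫ = s * ⟪x - y, w - y⟫ := by
      rw [real_inner_smul_left, real_inner_comm]
    simp only [Φ, h3, h4, norm_sub_sq_real (s • (w - y)), h7, norm_smul, Real.norm_eq_abs,
      abs_of_pos hs.1, smul_eq_mul] at h1 h2
    have h5 := mul_le_mul_of_nonneg_left h2 (by positivity : 0 ≤ 2 * h)
    have h6 : s * (2 * ⟪x - y, w - y⟫) ≤ s * (2 * h * (f w - f y) + s * ‖w - y‖ ^ 2) := by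
      linarith
    exact le_of_mul_le_mul_left h6 hs.1
  have hlim : Tendsto (fun s : ℝ => 2 * h * (f w - f y) + s * ‖w - y‖ ^ 2) (𝓝[>] 0)
      (𝓝 (2 * h * (f w - f y) + 0 * ‖w - y‖ ^ 2)) := by
    apply Tendsto.mono_left _ nhdsWithin_le_nhds
    apply Continuous.tendsto
    fun_prop
  have := ge_of_tendsto hlim (by
    filter_upwards [Ioo_mem_nhdsGT (zero_lt_one' ℝ)] with s hs using key s hs)
  linarith

end ConvexAnalysis

/-! ### Existence for a single mode by implicit Euler approximation. -/

section ImplicitEuler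

variable {n : ℕ} {f : EuclideanSpace ℝ (Fin n) → ℝ} {C : Set (EuclideanSpace ℝ (Fin n))}
  {x₀ : EuclideanSpace ℝ (Fin n)}

/-- `y` is a sequence of implicit Euler steps of size `h` for the subdifferential of `f`
restricted to `C`. -/
structure IsEulerSequence (f : EuclideanSpace ℝ (Fin n) → ℝ) (C : Set (EuclideanSpace ℝ (Fin n)))
    (h : ℝ) (y : ℕ → EuclideanSpace ℝ (Fin n)) : Prop where
  mem : ∀ k, y k ∈ C
  step : ∀ k, ∀ w ∈ C, ⟪y k - y (k + 1), w - y (k + 1)⟫ ≤ h * (f w - f (y (k + 1)))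

theorem exists_isEulerSequence (hf : ConvexOn ℝ univ f) (hCc : IsClosed C) (hC : Convex ℝ C)
    (hx : x₀ ∈ C) {h : ℝ} (hh : 0 < h) : ∃ y, IsEulerSequence f C h y ∧ y 0 = x₀ := by
  choose J hJC hJ using fun x : C => exists_resolvent hf hCc hC x.2 hh
  let z : ℕ → C := fun k => (fun x : C => (⟨J x, hJC x⟩ : C))^[k] ⟨x₀, hx⟩
  have hz : ∀ k, (z (k + 1) : EuclideanSpace ℝ (Fin n)) = J (z k) := fun k => by
    simp only [z, Function.iterate_succ_apply']
  refine ⟨fun k => z k, ⟨fun k => (z k).2, fun k w hw => ?_⟩, rfl⟩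
  simp only [hz]
  exact hJ (z k) w hw

namespace IsEulerSequence

variable {h : ℝ} {y : ℕ → EuclideanSpace ℝ (Fin n)}

theorem antitone (hy : IsEulerSequence f C h y) (hh : 0 < h) : Antitone fun k => f (y k) := by
  refine antitone_nat_of_succ_le fun k => ?_
  have h1 := hy.step k (y k) (hy.mem k)
  rw [real_inner_self_eq_norm_sq] at h1
  have h2 : 0 ≤ h * (f (y k) - f (y (k + 1))) := (sq_nonneg _).trans h1
  linarith [nonneg_of_mul_nonneg_right h2 hh]

/-- The subgradient at the start bounds the first step, and monotonicity makes step lengths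
nonincreasing. -/
theorem norm_succ_sub_le (hy : IsEulerSequence f C h y) (hh : 0 < h)
    {g : EuclideanSpace ℝ (Fin n)} (hg : g ∈ subdifferential f (y 0)) (k : ℕ) :
    ‖y (k + 1) - y k‖ ≤ h * ‖g‖ := by
  induction k with
  | zero =>
    have h1 := hy.step 0 (y 0) (hy.mem 0)
    rw [real_inner_self_eq_norm_sq, zero_add, norm_sub_rev] at h1
    have h2 := hg (y 1)
    have h3 := neg_le_of_abs_le (abs_real_inner_le_norm g (y 1 - y 0))
    rw [zero_add]
    have h4 : ‖y 1 - y 0‖ ^ 2 ≤ h * ‖g‖ * ‖y 1 - y 0‖ :=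
      h1.trans (by nlinarith)
    by_contra! hlt
    have : 0 < ‖y 1 - y 0‖ := lt_of_le_of_lt (by positivity) hlt
    nlinarith
  | succ k ih =>
    refine le_trans ?_ ih
    -- Two consecutive step inequalities are tested at each other's points, so the values of `f`
    -- cancel on addition.
    have h1 := hy.step k (y (k + 2)) (hy.mem _)
    have h2 := hy.step (k + 1) (y (k + 1)) (hy.mem _)
    rw [real_inner_self_eq_norm_sq, norm_sub_rev] at h2
    rw [← neg_sub, inner_neg_left] at h1
    have h3 := real_inner_le_norm (y (k + 1) - y k) (y (k + 2) - y (k + 1))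
    by_contra! hlt
    have h4 : 0 < ‖y (k + 2) - y (k + 1)‖ := lt_of_le_of_lt (norm_nonneg _) hlt
    have h5 : (k + 1 + 1) = k + 2 := rfl
    rw [h5] at h2 hlt
    nlinarith

theorem norm_sub_le (hy : IsEulerSequence f C h y) (hh : 0 < h)
    {g : EuclideanSpace ℝ (Fin n)} (hg : g ∈ subdifferential f (y 0)) (l m : ℕ) :
    ‖y m - y l‖ ≤ h * ‖g‖ * |(m : ℝ) - l| := by
  wlog hlm : l ≤ m generalizing l m
  · rw [norm_sub_rev, abs_sub_comm]
    exact this m l (le_of_not_ge hlm)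
  rw [abs_of_nonneg (sub_nonneg.2 (Nat.cast_le.2 hlm))]
  induction m, hlm using Nat.le_induction with
  | base => simp
  | succ m hm ih =>
    have h1 := hy.norm_succ_sub_le hh hg m
    have h2 := norm_sub_le_norm_sub_add_norm_sub (y (m + 1)) (y m) (y l)
    push_cast
    linarith

/-- The discrete evolution variational inequality. -/
theorem norm_sq_sub_le (hy : IsEulerSequence f C h y) (hh : 0 < h)
    {w : EuclideanSpace ℝ (Fin n)} (hw : w ∈ C) {l m : ℕ} (hlm : l ≤ m) :
    ‖y m - w‖ ^ 2 - ‖y l - w‖ ^ 2 ≤ 2 * (h * ((m : ℝ) - l)) * (f w - f (y m)) := by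
  induction m, hlm using Nat.le_induction with
  | base => simp
  | succ m hm ih =>
    have h1 := hy.step m w hw
    have h2 : f (y (m + 1)) ≤ f (y m) := hy.antitone hh m.le_succ
    have h3 : ‖y m - w‖ ^ 2 = ‖y m - y (m + 1)‖ ^ 2 - 2 * ⟪y m - y (m + 1), w - y (m + 1)⟫
        + ‖w - y (m + 1)‖ ^ 2 := by
      rw [← norm_sub_sq_real, sub_sub_sub_cancel_right]
    rw [norm_sub_rev w] at h3
    have h4 : 0 ≤ h * ((m : ℝ) - l) := mul_nonneg hh.le (sub_nonneg.2 (Nat.cast_le.2 hm))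
    -- Descent of `f` lets the accumulated bound use the last value `f (y (m + 1))`.
    have h5 := mul_le_mul_of_nonneg_left h2 h4
    push_cast
    nlinarith [sq_nonneg ‖y m - y (m + 1)‖]

end IsEulerSequence

theorem abs_floor_sub_floor_le (a b : ℝ) : |((⌊a⌋₊ : ℕ) : ℝ) - ⌊b⌋₊| ≤ |a - b| + 1 := by
  wlog hab : b ≤ a generalizing a b
  · rw [abs_sub_comm, abs_sub_comm a]
    exact this b a (le_of_not_ge hab)
  have h1 : ((⌊b⌋₊ : ℕ) : ℝ) ≤ ⌊a⌋₊ := Nat.cast_le.2 (Nat.floor_le_floor hab)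
  rw [abs_of_nonneg (sub_nonneg.2 h1), abs_of_nonneg (sub_nonneg.2 hab)]
  have h2 := Nat.lt_floor_add_one b
  rcases le_total 0 a with ha | ha
  · linarith [Nat.floor_le ha]
  · rw [Nat.floor_of_nonpos ha, Nat.floor_of_nonpos (hab.trans ha)]
    simp
    linarith

theorem tendsto_mul_floor_div (t : ℝ) (ht : 0 ≤ t) :
    Tendsto (fun N : ℕ => ((N : ℝ) + 1)⁻¹ * (⌊t * ((N : ℝ) + 1)⌋₊ : ℝ)) atTop (𝓝 t) := by
  have h1 : Tendsto (fun N : ℕ => (N : ℝ) + 1) atTop atTop :=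
    tendsto_atTop_add_const_right _ _ tendsto_natCast_atTop_atTop
  have h2 := (tendsto_nat_floor_mul_div_atTop ht).comp h1
  refine h2.congr fun N => ?_
  simp [div_eq_inv_mul]

/-- Integral solutions (in the sense of the evolution variational inequality). -/
theorem exists_evolution (hf : ConvexOn ℝ univ f) (hCc : IsClosed C) (hC : Convex ℝ C)
    (hx : x₀ ∈ C) :
    ∃ (φ : ℝ → EuclideanSpace ℝ (Fin n)) (K : NNReal), LipschitzWith K φ ∧ φ 0 = x₀ ∧
      (∀ t, φ t ∈ C) ∧ ∀ w ∈ C, ∀ s t, 0 ≤ s → s ≤ t →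
        ‖φ t - w‖ ^ 2 - ‖φ s - w‖ ^ 2 ≤ 2 * (t - s) * (f w - f (φ t)) := by
  obtain ⟨g, hg⟩ := subdifferential_nonempty hf x₀
  have hcont := continuous_of_convexOn hf
  have hpos : ∀ N : ℕ, 0 < ((N : ℝ) + 1)⁻¹ := fun N => by positivity
  choose y hy hy0 using fun N : ℕ => exists_isEulerSequence hf hCc hC hx (hpos N)
  -- Piecewise constant interpolation with step `1 / (N + 1)`; for `t < 0` the floor is `0`, so `X`
  -- extends by `x₀`.
  let X : ℝ → ℕ → EuclideanSpace ℝ (Fin n) := fun t N => y N ⌊t * ((N : ℝ) + 1)⌋₊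
  have hXdist : ∀ s t N, ‖X t N - X s N‖ ≤ ‖g‖ * (|t - s| + ((N : ℝ) + 1)⁻¹) := by
    intro s t N
    refine ((hy N).norm_sub_le (hpos N) (by rwa [hy0]) _ _).trans ?_
    have h1 := abs_floor_sub_floor_le (t * ((N : ℝ) + 1)) (s * ((N : ℝ) + 1))
    rw [← sub_mul, abs_mul, abs_of_pos (by positivity : (0 : ℝ) < N + 1)] at h1
    calc _ ≤ ((N : ℝ) + 1)⁻¹ * ‖g‖ * (|t - s| * ((N : ℝ) + 1) + 1) := by gcongr
      _ = _ := by field_simp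
  have hX0 : ∀ N, X 0 N = x₀ := by simp [X, hy0]
  -- Boundedness yields limits along `U` for all `t` at once, with no diagonal subsequence.
  let U : Ultrafilter ℕ := hyperfilter ℕ
  have hU : (U : Filter ℕ) ≤ atTop := Nat.hyperfilter_le_atTop
  have hlim : ∀ t, ∃ z, Tendsto (X t) U (𝓝 z) := by
    intro t
    have hK := isCompact_closedBall x₀ (‖g‖ * (|t| + 1))
    obtain ⟨z, -, hz⟩ := hK.ultrafilter_le_nhds (U.map (X t)) (by
      rw [le_principal_iff, Ultrafilter.coe_map, mem_map]
      refine univ_mem' fun N => ?_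
      rw [mem_preimage, Metric.mem_closedBall, dist_eq_norm, ← hX0 N]
      refine (hXdist 0 t N).trans ?_
      rw [sub_zero]
      gcongr
      exact inv_le_one_of_one_le₀ (by linarith [(Nat.cast_nonneg N : (0 : ℝ) ≤ N)]))
    exact ⟨z, hz⟩
  choose φ hφ using hlim
  have hinv : Tendsto (fun N : ℕ => ((N : ℝ) + 1)⁻¹) U (𝓝 0) := by
    simpa [one_div] using (tendsto_one_div_add_atTop_nhds_zero_nat (𝕜 := ℝ)).mono_left hU
  refine ⟨φ, ‖g‖₊, ?_, ?_, ?_, ?_⟩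
  · refine LipschitzWith.of_dist_le_mul fun t s => ?_
    rw [dist_eq_norm, Real.dist_eq, coe_nnnorm]
    have h1 := ((hφ t).sub (hφ s)).norm
    have h2 : Tendsto (fun N : ℕ => ‖g‖ * (|t - s| + ((N : ℝ) + 1)⁻¹)) U
        (𝓝 (‖g‖ * (|t - s| + 0))) := (hinv.const_add _).const_mul _
    rw [add_zero] at h2
    exact le_of_tendsto_of_tendsto' h1 h2 fun N => hXdist s t N
  · refine tendsto_nhds_unique (hφ 0) ?_
    simp only [funext hX0]
    exact tendsto_const_nhds
  · exact fun t => hCc.mem_of_tendsto (hφ t) (Eventually.of_forall fun N => (hy N).mem _)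
  · intro w hw s t hs hst
    have h1 := (((hφ t).sub_const w).norm.pow 2).sub (((hφ s).sub_const w).norm.pow 2)
    have h2 := (((((tendsto_mul_floor_div t (hs.trans hst)).mono_left hU).sub
      ((tendsto_mul_floor_div s hs).mono_left hU)).const_mul 2).mul
        (((hcont.tendsto _).comp (hφ t)).const_sub (f w)))
    refine le_of_tendsto_of_tendsto' h1 h2 fun N => ?_
    rw [← mul_sub]
    exact (hy N).norm_sq_sub_le (hpos N) hw (Nat.floor_le_floor (by gcongr))

theorem exists_flow (hf : ConvexOn ℝ univ f) (hCc : IsClosed C) (hC : Convex ℝ C) (hx : x₀ ∈ C) :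
    ∃ φ : ℝ → EuclideanSpace ℝ (Fin n), (∃ K, LipschitzWith K φ) ∧ φ 0 = x₀ ∧
      ∀ᵐ t : ℝ, 0 < t → ∃ v, HasDerivAt φ v t ∧ v ∈ -flowMap f C (φ t) := by
  obtain ⟨φ, K, hK, h0, hmem, hevi⟩ := exists_evolution hf hCc hC hx
  refine ⟨φ, ⟨K, hK⟩, h0, ?_⟩
  filter_upwards [hK.ae_differentiableAt_real] with t ht htpos
  refine ⟨deriv φ t, ht.hasDerivAt, ?_⟩
  rw [Set.mem_neg]
  refine mem_flowMap_of_forall_le hf hC (hmem t) fun w hw => ?_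
  have h1 : HasDerivAt (fun s => ‖φ s - w‖ ^ 2) (2 * ⟪φ t - w, deriv φ t⟫) t :=
    (ht.hasDerivAt.sub_const w).norm_sq
  -- Left difference quotients suffice: with `t` as the later time, the bound `f w - f (φ t)` does
  -- not depend on `s`.
  have h2 := (hasDerivAt_iff_tendsto_slope.1 h1).mono_left
    (nhdsWithin_mono t (fun s (hs : s < t) => hs.ne) : 𝓝[<] t ≤ 𝓝[≠] t)
  have h3 := le_of_tendsto (b := 2 * (f w - f (φ t))) h2 (by
    filter_upwards [Ioo_mem_nhdsLT htpos] with s hs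
    rw [slope_comm, slope_def_field, div_le_iff₀ (sub_pos.2 hs.2)]
    linarith [hevi w hw s t hs.1.le hs.2.le])
  rw [inner_neg_left, ← inner_neg_right, neg_sub, real_inner_comm]
  linarith

end ImplicitEuler

/-! ### Lipschitz images and monotonicity of absolutely continuous functions. -/

section AbsoluteContinuity

theorem _root_.LipschitzWith.comp_absolutelyContinuousOnInterval {X Y : Type*}
    [PseudoMetricSpace X] [PseudoMetricSpace Y] {K : NNReal} {G : X → Y} (hG : LipschitzWith K G)
    {φ : ℝ → X} {a b : ℝ} (hφ : AbsolutelyContinuousOnInterval φ a b) :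
    AbsolutelyContinuousOnInterval (fun t => G (φ t)) a b := by
  unfold AbsolutelyContinuousOnInterval at *
  refine squeeze_zero (fun E => Finset.sum_nonneg fun _ _ => dist_nonneg) (fun E => ?_)
    (by simpa using Tendsto.const_mul (K : ℝ) hφ)
  rw [Finset.mul_sum]
  exact Finset.sum_le_sum fun i _ => hG.dist_le_mul _ _

/-- An absolutely continuous function with almost everywhere nonpositive derivative
does not increase. -/
theorem _root_.AbsolutelyContinuousOnInterval.le_of_ae_hasDerivAt_nonpos {u : ℝ → ℝ} {a b : ℝ}
    (hab : a ≤ b) (hu : AbsolutelyContinuousOnInterval u a b)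
    (h : ∀ᵐ t, t ∈ Ioo a b → ∃ d ≤ 0, HasDerivAt u d t) : u b ≤ u a := by
  have h1 := hu.integral_deriv_eq_sub
  have h2 : ∀ᵐ t : ℝ, t ≠ b := by simp [ae_iff, measure_singleton]
  have h3 : ∫ t in a..b, deriv u t ≤ 0 := by
    rw [intervalIntegral.integral_of_le hab]
    refine integral_nonpos_of_ae ?_
    rw [EventuallyLE, ae_restrict_iff' measurableSet_Ioc]
    filter_upwards [h, h2] with t ht htb htab
    obtain ⟨d, hd, hd'⟩ := ht ⟨htab.1, lt_of_le_of_ne htab.2 htb⟩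
    rw [hd'.deriv]
    exact hd
  linarith

end AbsoluteContinuity

/-! ### Time domains are initial segments, hence nested. -/

section TimeDomain

variable {D D' : Set ℝ}

theorem IsTimeDomain.zero_mem (hD : IsTimeDomain D) : (0 : ℝ) ∈ D := by
  rcases hD with ⟨T, hT, rfl | rfl⟩ | rfl
  · exact ⟨le_rfl, hT⟩
  · exact ⟨le_rfl, hT.le⟩
  · exact mem_Ici.2 le_rfl

theorem IsTimeDomain.subset_Ici (hD : IsTimeDomain D) : D ⊆ Ici 0 := by
  rcases hD with ⟨T, hT, rfl | rfl⟩ | rfl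
  · exact Ico_subset_Ici_self
  · exact Icc_subset_Ici_self
  · exact Subset.rfl

theorem IsTimeDomain.Icc_subset (hD : IsTimeDomain D) {b : ℝ} (hb : b ∈ D) : Icc 0 b ⊆ D := by
  rcases hD with ⟨T, hT, rfl | rfl⟩ | rfl
  · exact fun t ht => ⟨ht.1, ht.2.trans_lt hb.2⟩
  · exact fun t ht => ⟨ht.1, ht.2.trans hb.2⟩
  · exact fun t ht => ht.1

theorem IsTimeDomain.subset_or_subset (hD : IsTimeDomain D) (hD' : IsTimeDomain D') :
    D ⊆ D' ∨ D' ⊆ D := by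
  by_contra! h
  obtain ⟨⟨b, hb, hb'⟩, c, hc, hc'⟩ := h.imp not_subset.1 not_subset.1
  rcases le_total b c with hbc | hbc
  · exact hb' (hD'.Icc_subset hc ⟨hD.subset_Ici hb, hbc⟩)
  · exact hc' (hD.Icc_subset hb ⟨hD'.subset_Ici hc, hbc⟩)

theorem IsTimeDomain.mem_nhds (hD : IsTimeDomain D) {b t : ℝ} (hb : b ∈ D) (ht : t ∈ Ioo 0 b) :
    D ∈ 𝓝 t :=
  mem_of_superset (Icc_mem_nhds ht.1 ht.2) (hD.Icc_subset hb)

end TimeDomain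

/-! ### Uniqueness, viability, velocity bounds and pasting. -/

section Solutions

variable {n p : ℕ} {f : Fin p → EuclideanSpace ℝ (Fin n) → ℝ}
  {C : Fin p → Set (EuclideanSpace ℝ (Fin n))} {σ : ℝ → Fin p} {D D' : Set ℝ}
  {φ φ' : ℝ → EuclideanSpace ℝ (Fin n)}

theorem IsSolution.absolutelyContinuousOnInterval (h : IsSolution f C σ D φ) {a b : ℝ}
    (ha : a ∈ D) (hb : b ∈ D) : AbsolutelyContinuousOnInterval φ a b :=
  h.locallyAC a ha b hb

theorem IsSolution.ae_hasDerivAt (h : IsSolution f C σ D φ) {b : ℝ} (hb : b ∈ D) :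
    ∀ᵐ t, t ∈ Ioo 0 b → ∃ v, HasDerivAt φ v t ∧ v ∈ -flowMap (f (σ t)) (C (σ t)) (φ t) := by
  filter_upwards [h.inclusion] with t ht htb
  obtain ⟨v, hv, hv'⟩ := ht (h.timeDomain.Icc_subset hb (Ioo_subset_Icc_self htb))
  exact ⟨v, hv.hasDerivAt (h.timeDomain.mem_nhds hb htb), hv'⟩

/-- Solutions with the same initial value agree on their common domain. -/
theorem IsSolution.eq_of_mem (h : IsSolution f C σ D φ) (h' : IsSolution f C σ D' φ')
    (h0 : φ 0 = φ' 0) {b : ℝ} (hb : b ∈ D) (hb' : b ∈ D') : φ b = φ' b := by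
  have hb0 : 0 ≤ b := h.timeDomain.subset_Ici hb
  have hw := (h.absolutelyContinuousOnInterval h.timeDomain.zero_mem hb).fun_sub
    (h'.absolutelyContinuousOnInterval h'.timeDomain.zero_mem hb')
  have hnorm := lipschitzWith_one_norm.comp_absolutelyContinuousOnInterval hw
  have hu := hnorm.fun_mul hnorm
  have hle := hu.le_of_ae_hasDerivAt_nonpos hb0 (by
    filter_upwards [h.ae_hasDerivAt hb, h'.ae_hasDerivAt hb'] with t ht ht' htb
    obtain ⟨v, hv, hv1⟩ := ht htb
    obtain ⟨v', hv', hv1'⟩ := ht' htb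
    refine ⟨2 * ⟪φ t - φ' t, v - v'⟫, ?_, ?_⟩
    · have h1 := inner_sub_nonneg_of_mem_flowMap hv1 hv1'
      rw [show -v - -v' = -(v - v') by abel, inner_neg_left, real_inner_comm] at h1
      linarith
    · simpa only [sq, Pi.sub_apply] using (hv.sub hv').norm_sq)
  simp only [h0, sub_self, norm_zero, mul_zero] at hle
  have : ‖φ b - φ' b‖ = 0 := mul_self_eq_zero.1 (le_antisymm hle (mul_self_nonneg _))
  exact sub_eq_zero.1 (norm_eq_zero.1 this)

/-- While the signal is constant, solutions stay in the corresponding closed set. -/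
theorem IsSolution.mem_of_eqOn (hC : ∀ q, IsClosed (C q)) (h : IsSolution f C σ D φ)
    {a b : ℝ} (ha : 0 ≤ a) (hab : a < b) (hb : b ∈ D) {q : Fin p} (hσ : ∀ s ∈ Ico a b, σ s = q)
    {t : ℝ} (ht : t ∈ Icc a b) : φ t ∈ C q := by
  -- The normal cone is empty off `C q`, so membership holds almost everywhere, hence densely.
  -- Closedness extends it to both endpoints, including `b`, where the signal may already have
  -- switched.
  let S : Set ℝ := {s | s ∈ Ioo a b → φ s ∈ C q}
  have hS : Dense S := by
    refine Measure.dense_of_ae (μ := volume) ?_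
    filter_upwards [h.ae_hasDerivAt hb] with s hs hsb
    obtain ⟨v, -, hv⟩ := hs ⟨ha.trans_lt hsb.1, hsb.2⟩
    rw [hσ s (Ioo_subset_Ico_self hsb)] at hv
    obtain ⟨_, _, w, hw, _⟩ := hv
    exact hw.1
  have hcl : t ∈ closure (Ioo a b ∩ S) := by
    refine closure_minimal (hS.open_subset_closure_inter isOpen_Ioo) isClosed_closure ?_
    rwa [closure_Ioo hab.ne]
  have hcont : ContinuousOn φ (Icc 0 b) := by
    have := (h.absolutelyContinuousOnInterval h.timeDomain.zero_mem hb).continuousOn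
    rwa [uIcc_of_le (ha.trans hab.le)] at this
  have hsub : Ioo a b ∩ S ⊆ Icc 0 b := fun s hs => ⟨ha.trans hs.1.1.le, hs.1.2.le⟩
  have h1 := ((hcont t ⟨ha.trans ht.1, ht.2⟩).mono hsub).mem_closure_image hcl
  refine closure_minimal ?_ (hC q) h1
  rintro _ ⟨s, hs, rfl⟩
  exact hs.2 hs.1

/-- Velocities are bounded by the subgradients, since they are orthogonal to the normal part. -/
theorem norm_le_of_mem_neg_flowMap {g : EuclideanSpace ℝ (Fin n) → ℝ}
    {A : Set (EuclideanSpace ℝ (Fin n))} {v : EuclideanSpace ℝ (Fin n)} {t L : ℝ}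
    (hv : HasDerivAt φ v t) (hvA : v ∈ -flowMap g A (φ t)) (hA : ∀ᶠ s in 𝓝 t, φ s ∈ A)
    (hL : ∀ y ∈ subdifferential g (φ t), ‖y‖ ≤ L) : ‖v‖ ≤ L := by
  obtain ⟨y, hy, w, hw, hyw⟩ := hvA
  have hyw : y + w = -v := hyw
  -- Normality of `w` at `φ t` makes `⟪w, φ s⟫` maximal at `s = t`, so `w` is orthogonal to `v`.
  have hmax : IsLocalMax (fun s => ⟪w, φ s⟫) t := by
    filter_upwards [hA] with s hs
    have := hw.2 (φ s) hs
    rw [inner_sub_right] at this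
    linarith
  have hder : HasDerivAt (fun s => ⟪w, φ s⟫) ⟪w, v⟫ t := by
    simpa using (hasDerivAt_const t w).inner ℝ hv
  have h0 : ⟪w, v⟫ = 0 := hmax.hasDerivAt_eq_zero hder
  have h1 : ‖v‖ ^ 2 = -⟪y, v⟫ := by
    have h := congrArg (fun z => ⟪z, v⟫) hyw
    simp only [inner_add_left, inner_neg_left, h0, real_inner_self_eq_norm_sq] at h
    linarith
  have h2 := neg_le_of_abs_le (abs_real_inner_le_norm y v)
  have h3 := hL y hy
  by_contra! hlt
  have : 0 < ‖v‖ := ((norm_nonneg y).trans h3).trans_lt hlt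
  nlinarith

theorem norm_sub_le_of_ae_hasDerivAt {L a b : ℝ} (hab : a ≤ b)
    (hφ : AbsolutelyContinuousOnInterval φ a b)
    (h : ∀ᵐ t, t ∈ Ioo a b → ∃ v, HasDerivAt φ v t ∧ ‖v‖ ≤ L) :
    ‖φ b - φ a‖ ≤ L * (b - a) := by
  set e := φ b - φ a with he
  have h1 : AbsolutelyContinuousOnInterval (fun t => ⟪e, φ t⟫) a b :=
    (innerSL ℝ e).lipschitz.comp_absolutelyContinuousOnInterval hφ
  have h2 : AbsolutelyContinuousOnInterval (fun t : ℝ => ‖e‖ * L * t) a b :=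
    (LipschitzWith.id.lipschitzOnWith (s := uIcc a b)).absolutelyContinuousOnInterval.const_mul _
  have h3 := (h1.fun_sub h2).le_of_ae_hasDerivAt_nonpos hab (by
    filter_upwards [h] with t ht htab
    obtain ⟨v, hv, hvL⟩ := ht htab
    refine ⟨⟪e, v⟫ - ‖e‖ * L * 1, ?_, ?_⟩
    · have := real_inner_le_norm e v
      nlinarith [norm_nonneg e]
    · refine HasDerivAt.sub ?_ ((hasDerivAt_id t).const_mul _)
      simpa using (hasDerivAt_const t e).inner ℝ hv)
  have h4 : ‖e‖ ^ 2 ≤ ‖e‖ * (L * (b - a)) := by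
    rw [← real_inner_self_eq_norm_sq]
    nth_rw 2 [he]
    rw [inner_sub_right]
    linarith
  -- If `e = 0`, the claim needs `0 ≤ L` when `a < b`; this comes from any single time with a
  -- bounded derivative.
  rcases (norm_nonneg e).eq_or_lt with h0 | h0
  · rw [← h0]
    rcases hab.eq_or_lt with rfl | hlt
    · simp
    · obtain ⟨t, ht, ht'⟩ : ∃ t ∈ Ioo a b, ∃ v, HasDerivAt φ v t ∧ ‖v‖ ≤ L := by
        by_contra! hne
        have : volume (Ioo a b) = 0 := by
          refine measure_mono_null ?_ (ae_iff.1 h)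
          intro t ht htv
          obtain ⟨v, hv, hvL⟩ := htv ht
          exact (hne t ht v hv).not_ge hvL
        simp at this
        linarith
      obtain ⟨v, -, hv⟩ := ht'
      exact mul_nonneg ((norm_nonneg v).trans hv) (by linarith)
  · exact le_of_mul_le_mul_left (by linarith) h0

theorem exists_mem_Ico_of_tendsto {τ : ℕ → ℝ} (hτ0 : τ 0 = 0) (hτ : Tendsto τ atTop atTop)
    {t : ℝ} (ht : 0 ≤ t) : ∃ j, t ∈ Ico (τ j) (τ (j + 1)) := by
  classical
  have hex : ∃ k, t < τ k := (hτ.eventually_gt_atTop t).exists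
  have hk0 : Nat.find hex ≠ 0 := by
    intro h0
    have := Nat.find_spec hex
    rw [h0, hτ0] at this
    linarith
  obtain ⟨j, hj⟩ := Nat.exists_eq_succ_of_ne_zero hk0
  refine ⟨j, not_lt.1 (Nat.find_min hex (by omega)), ?_⟩
  have := Nat.find_spec hex
  rwa [hj] at this

/-- Bounded solutions are uniformly continuous. -/
theorem IsSolution.uniformContinuousOn (hf : ∀ q, ConvexOn ℝ univ (f q))
    (hC : ∀ q, IsClosed (C q)) (hσ : IsSwitchingSignal σ) (h : IsSolution f C σ D φ)
    (hbdd : Bornology.IsBounded (φ '' D)) : UniformContinuousOn φ D := by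
  obtain ⟨τ, hτ0, hτm, hτ, hτσ⟩ := hσ
  obtain ⟨R, hR⟩ := hbdd.exists_norm_le
  choose L hL0 hL using fun q => exists_subgradient_bound (hf q) R
  have hLle : ∀ q, L q ≤ ∑ q, L q := fun q =>
    Finset.single_le_sum (fun i _ => hL0 i) (Finset.mem_univ q)
  -- Away from this null set, positive times lie in the interior of a mode, so `φ` stays in one set
  -- nearby.
  have hcount : ∀ᵐ t : ℝ, t ∉ range τ := (countable_range τ).ae_notMem _
  have hder : ∀ b ∈ D, ∀ᵐ t, t ∈ Ioo 0 b → ∃ v, HasDerivAt φ v t ∧ ‖v‖ ≤ ∑ q, L q := by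
    intro b hb
    filter_upwards [h.ae_hasDerivAt hb, hcount] with t ht htτ htb
    obtain ⟨v, hv, hvA⟩ := ht htb
    have htD : t ∈ D := h.timeDomain.Icc_subset hb (Ioo_subset_Icc_self htb)
    refine ⟨v, hv, norm_le_of_mem_neg_flowMap hv hvA ?_
      fun y hy => (hL _ _ (hR _ (mem_image_of_mem φ htD)) y hy).trans (hLle _)⟩
    obtain ⟨j, hj⟩ := exists_mem_Ico_of_tendsto hτ0 hτ htb.1.le
    have hlt : τ j < t := lt_of_le_of_ne hj.1 fun h => htτ ⟨j, h⟩
    have hm : t < min b (τ (j + 1)) := lt_min htb.2 hj.2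
    have hτj : 0 ≤ τ j := hτ0 ▸ hτm.monotone j.zero_le
    filter_upwards [Ioo_mem_nhds hlt hm] with s hs
    rw [hτσ j t hj]
    refine h.mem_of_eqOn hC hτj (hlt.trans hm) ?_ (q := σ (τ j)) ?_ (Ioo_subset_Icc_self hs)
    · exact h.timeDomain.Icc_subset hb ⟨(htb.1.trans hm).le, min_le_left _ _⟩
    · exact fun r hr => hτσ j r ⟨hr.1, hr.2.trans_le (min_le_right _ _)⟩
  have hlip : LipschitzOnWith (Real.toNNReal (∑ q, L q)) φ D := by
    refine LipschitzOnWith.of_dist_le_mul fun s hs t ht => ?_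
    wlog hst : s ≤ t generalizing s t
    · rw [dist_comm, dist_comm s]
      exact this t ht s hs (le_of_not_ge hst)
    rw [dist_comm, dist_comm s, dist_eq_norm, Real.dist_eq, abs_of_nonneg (sub_nonneg.2 hst),
      Real.coe_toNNReal _ (Finset.sum_nonneg fun i _ => hL0 i)]
    refine norm_sub_le_of_ae_hasDerivAt hst (h.absolutelyContinuousOnInterval hs ht) ?_
    filter_upwards [hder t ht] with r hr hrst
    exact hr ⟨(h.timeDomain.subset_Ici hs).trans_lt hrst.1, hrst.2⟩
  exact hlip.uniformContinuousOn

/-- Globally Lipschitz curves that solve the switching system on `(0, a)`. -/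
def IsLipschitzSolution (f : Fin p → EuclideanSpace ℝ (Fin n) → ℝ)
    (C : Fin p → Set (EuclideanSpace ℝ (Fin n))) (σ : ℝ → Fin p) (a : ℝ)
    (φ : ℝ → EuclideanSpace ℝ (Fin n)) : Prop :=
  (∃ K, LipschitzWith K φ) ∧
    ∀ᵐ t, t ∈ Ioo 0 a → ∃ v, HasDerivAt φ v t ∧ v ∈ -flowMap (f (σ t)) (C (σ t)) (φ t)

theorem IsLipschitzSolution.isSolution {a : ℝ} (h : IsLipschitzSolution f C σ a φ) (ha : 0 < a) :
    IsSolution f C σ (Icc 0 a) φ where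
  timeDomain := Or.inl ⟨a, ha, Or.inr rfl⟩
  locallyAC := fun _ _ _ _ =>
    let ⟨_, hK⟩ := h.1
    hK.lipschitzOnWith.absolutelyContinuousOnInterval
  inclusion := by
    have h1 : ∀ᵐ t : ℝ, t ≠ 0 := by simp [ae_iff, measure_singleton]
    have h2 : ∀ᵐ t : ℝ, t ≠ a := by simp [ae_iff, measure_singleton]
    filter_upwards [h.2, h1, h2] with t ht ht0 hta htI
    obtain ⟨v, hv, hv'⟩ := ht ⟨lt_of_le_of_ne htI.1 ht0.symm, lt_of_le_of_ne htI.2 hta⟩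
    exact ⟨v, hv.hasDerivWithinAt, hv'⟩

theorem IsLipschitzSolution.exists_extension (hf : ∀ q, ConvexOn ℝ univ (f q))
    (hCc : ∀ q, IsClosed (C q)) (hC : ∀ q, Convex ℝ (C q)) {a b : ℝ} (ha : 0 ≤ a)
    (h : IsLipschitzSolution f C σ a φ) {q : Fin p} (hφ : φ a ∈ C q)
    (hσ : ∀ s ∈ Ico a b, σ s = q) :
    ∃ φ', IsLipschitzSolution f C σ b φ' ∧ φ' 0 = φ 0 := by
  obtain ⟨ψ, ⟨K', hK'⟩, hψ0, hψ⟩ := exists_flow (hf q) (hCc q) (hC q) hφ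
  obtain ⟨⟨K, hK⟩, hφd⟩ := h
  -- The clamps follow `φ` up to `a` and the shifted `ψ` afterwards; being 1-Lipschitz, they keep
  -- `χ` globally Lipschitz.
  let χ : ℝ → EuclideanSpace ℝ (Fin n) := fun t => φ (min t a) + (ψ (max (t - a) 0) - φ a)
  have hleft : ∀ t ≤ a, χ t = φ t := fun t ht => by
    simp [χ, min_eq_left ht, max_eq_right (sub_nonpos.2 ht), hψ0]
  have hright : ∀ t, a ≤ t → χ t = ψ (t - a) := fun t ht => by
    simp [χ, min_eq_right ht, max_eq_left (sub_nonneg.2 ht)]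
  refine ⟨χ, ⟨⟨K * 1 + (K' * (1 + 0) + 0), ?_⟩, ?_⟩, hleft 0 ha⟩
  · refine (hK.comp (LipschitzWith.id.min_const a)).add
      ((hK'.comp ((LipschitzWith.id.sub (LipschitzWith.const a)).max_const 0)).sub
        (LipschitzWith.const _))
  · have h1 : ∀ᵐ t : ℝ, t ≠ a := by simp [ae_iff, measure_singleton]
    have h2 := (measurePreserving_sub_right volume a).quasiMeasurePreserving.ae hψ
    filter_upwards [hφd, h1, h2] with t htφ hta htψ htb
    rcases lt_or_gt_of_ne hta with hlt | hgt
    · obtain ⟨v, hv, hv'⟩ := htφ ⟨htb.1, hlt⟩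
      refine ⟨v, hv.congr_of_eventuallyEq ?_, by rwa [hleft t hlt.le]⟩
      filter_upwards [Iio_mem_nhds hlt] with s hs using hleft s (le_of_lt hs)
    · obtain ⟨v, hv, hv'⟩ := htψ (sub_pos.2 hgt)
      refine ⟨v, (hv.comp_sub_const t a).congr_of_eventuallyEq ?_, ?_⟩
      · filter_upwards [Ioi_mem_nhds hgt] with s hs using hright s (le_of_lt hs)
      · rwa [hright t hgt.le, hσ t ⟨hgt.le, htb.2⟩]

/-- Compatible solutions on `[0, τ j]` for all `j` glue to a complete solution. -/
theorem exists_complete_solution {τ : ℕ → ℝ} (hτ0 : τ 0 = 0) (hτm : StrictMono τ)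
    (hτ : Tendsto τ atTop atTop) {x₀ : EuclideanSpace ℝ (Fin n)}
    (h : ∀ j, ∃ φ, IsLipschitzSolution f C σ (τ j) φ ∧ φ 0 = x₀) :
    ∃ φ, IsSolution f C σ (Ici 0) φ ∧ φ 0 = x₀ := by
  have hpos : ∀ j, 0 < τ (j + 1) := fun j => hτ0 ▸ hτm j.succ_pos
  choose Φ hΦ hΦ0 using h
  have hsol := fun j => (hΦ (j + 1)).isSolution (hpos j)
  choose k hk using fun t : ℝ => fun ht : 0 ≤ t => exists_mem_Ico_of_tendsto hτ0 hτ ht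
  classical
  let φ : ℝ → EuclideanSpace ℝ (Fin n) := fun t => if ht : 0 ≤ t then Φ (k t ht + 1) t else x₀
  have hφ : ∀ j, EqOn φ (Φ (j + 1)) (Icc 0 (τ (j + 1))) := by
    intro j t ht
    simp only [φ, dif_pos ht.1]
    exact (hsol _).eq_of_mem (hsol j) (by rw [hΦ0, hΦ0]) ⟨ht.1, (hk t ht.1).2.le⟩ ht
  refine ⟨φ, ⟨Or.inr rfl, fun a ha b hb => ?_, ?_⟩, ?_⟩
  · obtain ⟨j, hj⟩ := exists_mem_Ico_of_tendsto hτ0 hτ (le_max_of_le_left ha : 0 ≤ max a b)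
    have hsub : uIcc a b ⊆ Icc 0 (τ (j + 1)) := fun t ht =>
      ⟨(le_min ha hb).trans ht.1, ht.2.trans hj.2.le⟩
    obtain ⟨⟨K, hK⟩, -⟩ := hΦ (j + 1)
    have hlip : LipschitzOnWith K φ (uIcc a b) := fun s hs t ht => by
      rw [hφ j (hsub hs), hφ j (hsub ht)]
      exact hK s t
    exact hlip.absolutelyContinuousOnInterval
  · have h1 : ∀ᵐ t : ℝ, t ≠ 0 := by simp [ae_iff, measure_singleton]
    filter_upwards [ae_all_iff.2 fun j => (hΦ (j + 1)).2, h1] with t ht ht0 htI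
    have htpos : 0 < t := lt_of_le_of_ne htI ht0.symm
    obtain ⟨j, hj⟩ := exists_mem_Ico_of_tendsto hτ0 hτ htpos.le
    obtain ⟨v, hv, hv'⟩ := ht j ⟨htpos, hj.2⟩
    refine ⟨v, (hv.congr_of_eventuallyEq ?_).hasDerivWithinAt, ?_⟩
    · filter_upwards [Icc_mem_nhds htpos hj.2] with s hs using hφ j hs
    · rwa [hφ j ⟨htpos.le, hj.2.le⟩]
  · rw [hφ 0 ⟨le_rfl, (hpos 0).le⟩, hΦ0]

theorem exists_isMaximalSolution (hf : ∀ q, ConvexOn ℝ univ (f q))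
    (hCc : ∀ q, IsClosed (C q)) (hC : ∀ q, Convex ℝ (C q)) (hσ : IsSwitchingSignal σ)
    {x₀ : EuclideanSpace ℝ (Fin n)} (hx₀ : x₀ ∈ C (σ 0)) :
    ∃ D φ, IsMaximalSolution f C σ D φ ∧ φ 0 = x₀ ∧ ((∀ q q', C q = C q') → D = Ici 0) := by
  obtain ⟨τ, hτ0, hτm, hτ, hτσ⟩ := hσ
  have hnonneg : ∀ j, 0 ≤ τ j := fun j => hτ0 ▸ hτm.monotone j.zero_le
  by_cases h : ∀ j, ∃ φ, IsLipschitzSolution f C σ (τ j) φ ∧ φ 0 = x₀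
  · obtain ⟨φ, hφ, hφ0⟩ := exists_complete_solution hτ0 hτm hτ h
    exact ⟨Ici 0, φ, ⟨hφ, fun D' φ' hφ' hsub _ => hφ'.timeDomain.subset_Ici.antisymm hsub⟩, hφ0,
      fun _ => rfl⟩
  obtain ⟨j, ⟨φ, hφ, hφ0⟩, hj⟩ : ∃ j, (∃ φ, IsLipschitzSolution f C σ (τ j) φ ∧ φ 0 = x₀) ∧
      ¬ ∃ φ, IsLipschitzSolution f C σ (τ (j + 1)) φ ∧ φ 0 = x₀ := by
    by_contra! hstep
    refine h fun j => ?_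
    induction j with
    | zero =>
      refine ⟨fun _ => x₀, ⟨⟨0, LipschitzWith.const x₀⟩, ?_⟩, rfl⟩
      rw [hτ0]
      simp
    | succ j ih => exact hstep j ih
  have hout : φ (τ j) ∉ C (σ (τ j)) := by
    intro hmem
    obtain ⟨φ', h1, h2⟩ := hφ.exists_extension hf hCc hC (hnonneg j) hmem (hτσ j)
    exact hj ⟨φ', h1, h2.trans hφ0⟩
  -- Failure at time `0` is excluded by `x₀ ∈ C (σ 0)`, so the domain has positive length.
  obtain ⟨i, rfl⟩ : ∃ i, j = i + 1 := by
    refine Nat.exists_eq_succ_of_ne_zero ?_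
    rintro rfl
    rw [hτ0, hφ0] at hout
    exact hout hx₀
  have hpos : 0 < τ (i + 1) := hτ0 ▸ hτm i.succ_pos
  have hsol := hφ.isSolution hpos
  refine ⟨Icc 0 (τ (i + 1)), φ, ⟨hsol, fun D' φ' hφ' hsub heq => ?_⟩, hφ0, fun hCeq => ?_⟩
  · refine Subset.antisymm (fun c hc => ⟨hφ'.timeDomain.subset_Ici hc, ?_⟩) hsub
    by_contra! hlt
    -- A longer solution would spend a nontrivial interval in the next mode, placing its value at `τ
    -- (i + 1)` in that mode's set, against `hout`.
    have hlt' : τ (i + 1) < min c (τ (i + 2)) := lt_min hlt (hτm (Nat.lt_succ_self _))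
    refine hout ?_
    rw [← heq ⟨hpos.le, le_rfl⟩]
    refine hφ'.mem_of_eqOn hCc hpos.le hlt' ?_
      (fun s hs => hτσ (i + 1) s ⟨hs.1, hs.2.trans_le (min_le_right _ _)⟩) ⟨le_rfl, hlt'.le⟩
    exact hφ'.timeDomain.Icc_subset hc ⟨(hpos.trans hlt').le, min_le_left _ _⟩
  -- With equal sets, the preceding mode already keeps `φ (τ (i + 1))` in the set that `hout`
  -- excludes.
  · refine absurd ?_ hout
    rw [hCeq _ (σ (τ i))]
    have hlt : τ i < τ (i + 1) := hτm (Nat.lt_succ_self i)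
    exact hsol.mem_of_eqOn hCc (hnonneg i) hlt ⟨hpos.le, le_rfl⟩ (hτσ i) ⟨hlt.le, le_rfl⟩

theorem IsMaximalSolution.unique (h : IsMaximalSolution f C σ D φ)
    (h' : IsMaximalSolution f C σ D' φ') (h0 : φ' 0 = φ 0) : D' = D ∧ EqOn φ' φ D := by
  have heq : ∀ t ∈ D, t ∈ D' → φ' t = φ t := fun t ht ht' => h'.1.eq_of_mem h.1 h0 ht' ht
  have hD : D' = D := by
    rcases h.1.timeDomain.subset_or_subset h'.1.timeDomain with hsub | hsub
    · exact h.2 D' φ' h'.1 hsub fun t ht => heq t ht (hsub ht)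
    · exact (h'.2 D φ h.1 hsub fun t ht => (heq t (hsub ht) ht).symm).symm
  exact ⟨hD, fun t ht => heq t ht (hD ▸ ht)⟩

end Solutions

end SwitchingSystem

theorem proposition1 {n p : ℕ} (f : Fin p → EuclideanSpace ℝ (Fin n) → ℝ)
    (C : Fin p → Set (EuclideanSpace ℝ (Fin n)))
    (hf : ∀ q, ConvexOn ℝ Set.univ (f q))
    (hC_nonempty : ∀ q, (C q).Nonempty)
    (hC_closed : ∀ q, IsClosed (C q))
    (hC_convex : ∀ q, Convex ℝ (C q))
    (σ : ℝ → Fin p) (hσ : SwitchingSystem.IsSwitchingSignal σ)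
    (x₀ : EuclideanSpace ℝ (Fin n)) (hx₀ : x₀ ∈ C (σ 0)) :
    ∃ (D : Set ℝ) (φ : ℝ → EuclideanSpace ℝ (Fin n)),
      (SwitchingSystem.IsMaximalSolution f C σ D φ ∧ φ 0 = x₀) ∧
      (∀ (D' : Set ℝ) (φ' : ℝ → EuclideanSpace ℝ (Fin n)),
        SwitchingSystem.IsMaximalSolution f C σ D' φ' → φ' 0 = x₀ →
          D' = D ∧ Set.EqOn φ' φ D) ∧
      (Bornology.IsBounded (φ '' D) → UniformContinuousOn φ D) ∧
      ((∀ q q', C q = C q') → D = Set.Ici 0) := by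
  obtain ⟨D, φ, hmax, h0, hcomplete⟩ :=
    SwitchingSystem.exists_isMaximalSolution hf hC_closed hC_convex hσ hx₀
  exact ⟨D, φ, ⟨hmax, h0⟩, fun D' φ' h' h0' => hmax.unique h' (h0'.trans h0.symm),
    hmax.1.uniformContinuousOn hf hC_closed hσ, hcomplete⟩
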